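/- Let $X$ and $Y$ be real Banach spaces, let $K\subseteq Y$ be a closed, convex, pointed ($K\cap(-K)=\{0\}$) cone with nonempty interior, and let $e\in\operatorname{int}K$. Let $F:X\rightrightarrows Y$ be a set-valued mapping with $\operatorname{dom}F=\{x\in X\mid F(x)\neq\emptyset\}$, let $\Omega\subseteq X$ be closed with $\Omega\subseteq\operatorname{int}\operatorname{dom}F$, and let $\bar x\in\Omega$. For $A,B\subseteq Y$ write $A\preceq^{(l)}_K B$ if $B\subseteq A+K$, and $A\sim^{(l)}_K B$ if $A\preceq^{(l)}_K B$ and $B\preceq^{(l)}_K A$. Put $$\operatorname{Min}(A,K)=\{y\in A\mid (y-K)\cap A=\{y\}\},\qquad \mathcal E_F(x)=F(x)+K,$$ $$\Psi_e(y)=\inf\{t\in\mathbb R\mid y\in te-K\},\qquad f_{l,\bar x}(x)=\sup_{z\in F(\bar x)}\ \inf_{y\in F(x)}\Psi_e(y-z),$$ with values in $\overline{\mathbb R}$. For a subset $S$ of a Banach space $E$, a point $x\in S$ and $\varepsilon\ge 0$, let $$\hat N_\varepsilon(x,S)=\Big\{x^*\in E^*\ \Big|\ \limsup_{u\to x,\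 u\in S\setminus\{x\}}\frac{\langle x^*,u-x\rangle}{\|u-x\|}\le\varepsilon\Big\},$$ and $\hat N_\varepsilon(x,S)=\emptyset$ if $x\notin S$. For $\bar z\in S$, the limiting normal cone $N(\bar z,S)$ is the set of all $x^*\in E^*$ for which there are $\varepsilon_k\downarrow 0$, $x_k\to\bar z$ and $x_k^*\in\hat N_{\varepsilon_k}(x_k,S)$ such that $x_k^*\to x^*$ in the weak$^*$ topology; $N(\bar z,S)=\emptyset$ if $\bar z\notin S$. For $f:E\to\overline{\mathbb R}$ finite at $\bar z$, the limiting subdifferential is $\partial f(\bar z)=\{x^*\mid (x^*,-1)\in N((\bar z,f(\bar z)),\operatorname{epi}f)\}$, and $\partial f(\bar z)=\emptyset$ if $f(\bar z)$ is infinite. For $G:X\rightrightarrows Y$, the coderivative is $D^*G(\bar x,\bar y)(y^*)=\{x^*\in X^*\mid (x^*,-y^*)\in N((\bar x,\bar y),\operatorname{gph}G)\}$, and $D^*G(\bar x,\bar y)[C]=\bigcup_{y^*\in C}D^*G(\bar x,\bar y)(y^*)$ for $C\subseteq Y^*$. Suppose that 1. $F$ is $\preceq^{(l)}_K$-convex: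 $F(\lambda x_1+(1-\lambda)x_2)\preceq^{(l)}_K\lambda F(x_1)+(1-\lambda)F(x_2)$ for all $x_1,x_2\in\operatorname{dom}F$ and $\lambda\in(0,1)$; 2. $F$ is locally $l$-bounded at $\bar x$: there are a neighbourhood $U$ of $\bar x$ and constants $\mu,\mu'>0$ such that $F(x)\cap(\mu e-K)\sim^{(l)}_K F(x)$ and $F(x)\subseteq-\mu' e+K$ for all $x\in U$; 3. $F(\bar x)$ is strongly $K$-compact: there is a compact set $B\subseteq F(\bar x)$ with $B\sim^{(l)}_K F(\bar x)$. Then $$\partial f_{l,\bar x}(\bar x)=\overline{\operatorname{conv}}^{*}\Big(\bigcup_{\bar y\in\operatorname{Min}(F(\bar x),K)}D^*\mathcal E_F(\bar x,\bar y)\big[\partial\Psi_e(0)\big]\Big),$$ where $\overline{\operatorname{conv}}^{*}$ denotes the weak$^*$ closure of the convex hull in $X^*$. The same formula holds when the left-hand side is replaced by the subdifferential of convex analysis of $f_{l,\bar x}$ at $\bar x$, that is, by $\{x^*\in X^*\mid f_{l,\bar x}(x)\ge f_{l,\bar x}(\bar x)+\langle x^*,x-\bar x\rangle\ \ \forall x\in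 X\}$ if $f_{l,\bar x}(\bar x)$ is finite, and by $\emptyset$ otherwise. -/

import Mathlib

open Set Filter Topology
open scoped Pointwise

namespace SetOpt

section Cone

variable {X Y : Type*} [NormedAddCommGroup X] [NormedSpace ℝ X]
  [NormedAddCommGroup Y] [NormedSpace ℝ Y]

/-- The domain of a set-valued mapping. -/
def dom (F : X → Set Y) : Set X := {x | (F x).Nonempty}

/-- The graph of a set-valued mapping. -/
def gph (F : X → Set Y) : Set (X × Y) := {p | p.2 ∈ F p.1}

/-- The epigraphical multifunction `x ↦ F x + K`. -/
def epiMap (K : Set Y) (F : X → Set Y) : X → Set Y := fun x => F x + K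

/-- The set `Min (A, K)` of minimal elements of `A` with respect to `K`. -/
def MinSet (A K : Set Y) : Set Y := {y | y ∈ A ∧ ({y} - K) ∩ A = {y}}

/-- The lower less relation: `A` precedes `B` if and only if `B ⊆ A + K`. -/
def LowerLess (K A B : Set Y) : Prop := B ⊆ A + K

/-- The equivalence relation attached to the lower less relation. -/
def LowerEquiv (K A B : Set Y) : Prop := LowerLess K A B ∧ LowerLess K B A

/-- Convexity of a set-valued mapping with respect to the lower less relation. -/
def LowerConvex (K : Set Y) (F : X → Set Y) : Prop :=
  ∀ x₁ ∈ dom F, ∀ x₂ ∈ dom F, ∀ t : ℝ, 0 < t → t < 1 →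
    LowerLess K (F (t • x₁ + (1 - t) • x₂)) (t • F x₁ + (1 - t) • F x₂)

/-- `F` is `l`-upper bounded on `U`. -/
def LUpperBoundedOn (K : Set Y) (e : Y) (F : X → Set Y) (U : Set X) : Prop :=
  ∃ μ : ℝ, 0 < μ ∧ ∀ x ∈ U, LowerEquiv K (F x ∩ ({μ • e} - K)) (F x)

/-- `F` is `l`-lower bounded on `U`. -/
def LLowerBoundedOn (K : Set Y) (e : Y) (F : X → Set Y) (U : Set X) : Prop :=
  ∃ μ : ℝ, 0 < μ ∧ (⋃ x ∈ U, F x) ⊆ {-(μ • e)} + K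

/-- `F` is locally `l`-bounded at `x₀`. -/
def LocallyLBounded (K : Set Y) (e : Y) (F : X → Set Y) (x₀ : X) : Prop :=
  ∃ U ∈ 𝓝 x₀, LUpperBoundedOn K e F U ∧ LLowerBoundedOn K e F U

/-- `A` is strongly `K`-compact. -/
def StronglyCompact (K A : Set Y) : Prop :=
  ∃ B ⊆ A, IsCompact B ∧ LowerEquiv K B A

/-- The nonlinear scalarizing functional `y ↦ inf {t ∈ ℝ | y ∈ t e - K}`, with values in the
extended reals. -/
noncomputable def Psi (K : Set Y) (e : Y) (y : Y) : EReal :=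
  sInf ((fun t : ℝ => (t : EReal)) '' {t : ℝ | y ∈ {t • e} - K})

/-- The lower inner function `(x, z) ↦ inf_{y ∈ F x} Ψ (y - z)`. -/
noncomputable def gLower (K : Set Y) (e : Y) (F : X → Set Y) (x : X) (z : Y) : EReal :=
  ⨅ y ∈ F x, Psi K e (y - z)

/-- The lower scalarizing functional `x ↦ sup_{z ∈ F x₀} inf_{y ∈ F x} Ψ (y - z)`. -/
noncomputable def fLower (K : Set Y) (e : Y) (F : X → Set Y) (x₀ x : X) : EReal :=
  ⨆ z ∈ F x₀, gLower K e F x z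

end Cone

section Variational

variable {E X Y : Type*} [NormedAddCommGroup E] [NormedSpace ℝ E]
  [NormedAddCommGroup X] [NormedSpace ℝ X] [NormedAddCommGroup Y] [NormedSpace ℝ Y]

/-- The set of `ε`-normals to `S` at `x`; it is empty if `x ∉ S`. The upper limit is taken in the
extended reals, so that it is `⊥` at an isolated point of `S`. -/
def epsNormals (ε : ℝ) (S : Set E) (x : E) : Set (StrongDual ℝ E) :=
  {φ | x ∈ S ∧
    limsup (fun u => ((φ (u - x) / ‖u - x‖ : ℝ) : EReal)) (𝓝[S \ {x}] x) ≤ (ε : EReal)}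

/-- The limiting (Mordukhovich) normal cone to `S` at `x₀`: the sequential Painlevé-Kuratowski
outer limit, in the norm topology of `E` and the weak-star topology of its dual, of the sets of
`ε`-normals at `x`, as `x → x₀` and `ε ↓ 0`; it is empty if `x₀ ∉ S`. -/
def limitingNormalCone (S : Set E) (x₀ : E) : Set (StrongDual ℝ E) :=
  {φ | x₀ ∈ S ∧ ∃ (ε : ℕ → ℝ) (x : ℕ → E) (ψ : ℕ → StrongDual ℝ E),
    (∀ k, 0 < ε k) ∧ Tendsto ε atTop (𝓝 0) ∧ Tendsto x atTop (𝓝 x₀) ∧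
    Tendsto (fun k => StrongDual.toWeakDual (ψ k)) atTop (𝓝 (StrongDual.toWeakDual φ)) ∧
    ∀ k, ψ k ∈ epsNormals (ε k) S (x k)}

/-- The basic coderivative of `G` at `(x₀, y₀)`: the `x*` such that `(x*, -y*)` is a limiting
normal to the graph. -/
def coderivative (G : X → Set Y) (x₀ : X) (y₀ : Y) (ystar : StrongDual ℝ Y) :
    Set (StrongDual ℝ X) :=
  {xstar | ContinuousLinearMap.coprod xstar (-ystar) ∈ limitingNormalCone (gph G) (x₀, y₀)}

/-- The epigraph of an extended-real-valued function. -/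
def epi (f : X → EReal) : Set (X × ℝ) := {p | f p.1 ≤ (p.2 : EReal)}

/-- The limiting (Mordukhovich) subdifferential of `f` at `x₀`: the `x*` such that `(x*, -1)` is a
limiting normal to the epigraph at `(x₀, f x₀)`; it is empty if `f x₀` is infinite. -/
noncomputable def limitingSubdiff (f : X → EReal) (x₀ : X) : Set (StrongDual ℝ X) :=
  {xstar | f x₀ ≠ ⊤ ∧ f x₀ ≠ ⊥ ∧
    ContinuousLinearMap.coprod xstar (-ContinuousLinearMap.id ℝ ℝ) ∈
      limitingNormalCone (epi f) (x₀, (f x₀).toReal)}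

/-- The subdifferential of `f` at `x₀` in the sense of convex analysis; it is empty if `f x₀` is
infinite. -/
def convexSubdiff (f : X → EReal) (x₀ : X) : Set (StrongDual ℝ X) :=
  {xstar | f x₀ ≠ ⊤ ∧ f x₀ ≠ ⊥ ∧ ∀ x, f x₀ + ((xstar (x - x₀) : ℝ) : EReal) ≤ f x}

/-- The closure of the convex hull of a set of functionals in the weak-star topology. -/
def wstarClosedConvexHull (A : Set (StrongDual ℝ X)) : Set (StrongDual ℝ X) :=
  StrongDual.toWeakDual ⁻¹' closure (StrongDual.toWeakDual '' convexHull ℝ A)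

end Variational

end SetOpt

open SetOpt

/-! Lower convexity of `F` makes the epigraph of `fLower` and the graph of `epiMap` convex; the
epigraph of `Psi` is convex as well. On a convex set in a Banach space limiting normals are the
normals of convex analysis (`mem_limitingNormalCone_iff_of_convex`), so both formulas are one
statement about subgradient inequalities.

The right-hand side lies in the left: if `ξ` is in the coderivative at `(y, η)`, then `ξ (x - x₀) ≤
η (v - y) ≤ Psi (v - y)` for all `v ∈ F x`; take the infimum over `v`, then bound by the supremum
over `F x₀`. The convex subdifferential is convex and weak-star closed, so it absorbs the hull.

Conversely, a subgradient `φ` outside the hull is separated from it by a direction `d` and a level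
`c < φ d`, so `fLower (x₀ + t d) > t c` for every `t > 0`. Compactness and monotone difference
quotients yield a single minimal `m` with `gLower (x₀ + t d) m ≥ t c` for all `t > 0`
(`exists_mem_MinSet_forall_le_gLower`). Hahn-Banach then produces an element `ξ` of the coderivative
at `m` with `ξ d ≥ c` (`exists_support_of_ray`), contradicting the separation.

If `0 ∈ interior K`, then `Psi` and `fLower` at `x₀` are `⊥` and both sides are empty. -/

namespace SetOpt

/-! ### Normal cones and subdifferentials in the convex case -/

section NormalCone

variable {E : Type*} [NormedAddCommGroup E] [NormedSpace ℝ E]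

/-- The segment from `x` to `u` stays in `S` and the quotient is constant along it, so the upper
limit controls that constant. -/
theorem apply_sub_le_of_mem_epsNormals {S : Set E} (hS : Convex ℝ S) {ε : ℝ} {x u : E}
    {φ : StrongDual ℝ E} (hφ : φ ∈ epsNormals ε S x) (hu : u ∈ S) :
    φ (u - x) ≤ ε * ‖u - x‖ := by
  obtain ⟨hx, hlim⟩ := hφ
  rcases eq_or_ne u x with rfl | hne
  · simp
  have hpos : 0 < ‖u - x‖ := norm_pos_iff.2 (sub_ne_zero.2 hne)
  rw [← div_le_iff₀ hpos]
  have hray : Tendsto (fun t : ℝ => x + t • (u - x)) (𝓝[>] 0) (𝓝[S \ {x}] x) := by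
    refine tendsto_nhdsWithin_iff.2 ⟨?_, ?_⟩
    · have : Continuous fun t : ℝ => x + t • (u - x) := by fun_prop
      simpa using (this.tendsto 0).mono_left nhdsWithin_le_nhds
    · filter_upwards [Ioo_mem_nhdsGT (zero_lt_one' ℝ)] with t ht
      refine ⟨hS.add_smul_sub_mem hx hu ⟨ht.1.le, ht.2.le⟩, ?_⟩
      simpa [sub_eq_zero, ht.1.ne'] using hne
  have hfreq : ∃ᶠ v in 𝓝[S \ {x}] x,
      ((φ (u - x) / ‖u - x‖ : ℝ) : EReal) ≤ ((φ (v - x) / ‖v - x‖ : ℝ) : EReal) := by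
    refine hray.frequently (Eventually.frequently ?_)
    filter_upwards [self_mem_nhdsWithin] with t ht
    have ht : (0 : ℝ) < t := ht
    rw [add_sub_cancel_left, map_smul, norm_smul, Real.norm_of_nonneg ht.le, smul_eq_mul,
      mul_div_mul_left _ _ ht.ne']
  exact EReal.coe_le_coe_iff.1 ((le_limsup_of_frequently_le hfreq).trans hlim)

theorem mem_limitingNormalCone_iff_of_convex [CompleteSpace E] {S : Set E} (hS : Convex ℝ S)
    {x : E} {φ : StrongDual ℝ E} :
    φ ∈ limitingNormalCone S x ↔ x ∈ S ∧ ∀ u ∈ S, φ (u - x) ≤ 0 := by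
  refine and_congr_right fun hx => ⟨?_, fun h => ?_⟩
  · rintro ⟨ε, y, ψ, -, hε, hy, hψ, hn⟩ u hu
    have heval (v : E) : Tendsto (fun k => ψ k v) atTop (𝓝 (φ v)) :=
      ((WeakDual.eval_continuous v).tendsto _).comp hψ
    -- Weak-star convergence only gives pointwise limits; a uniform norm bound is needed because the
    -- base points `y k` move too.
    obtain ⟨C, hC⟩ := banach_steinhaus (g := ψ) fun v => by
      obtain ⟨C, hC⟩ := (heval v).norm.bddAbove_range
      exact ⟨C, fun k => hC ⟨k, rfl⟩⟩
    have hsmall : Tendsto (fun k => ψ k (x - y k)) atTop (𝓝 0) := by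
      refine squeeze_zero_norm (a := fun k => C * ‖x - y k‖)
        (fun k => (ψ k).le_of_opNorm_le (hC k) _) ?_
      simpa using ((tendsto_const_nhds (x := x)).sub hy).norm.const_mul C
    have hleft : Tendsto (fun k => ψ k (u - y k)) atTop (𝓝 (φ (u - x))) := by
      have := (heval (u - x)).add hsmall
      simpa only [← map_add, sub_add_sub_cancel, add_zero] using this
    have hright : Tendsto (fun k => ε k * ‖u - y k‖) atTop (𝓝 0) := by
      simpa using hε.mul ((tendsto_const_nhds (x := u)).sub hy).norm
    exact le_of_tendsto_of_tendsto' hleft hright fun k => apply_sub_le_of_mem_epsNormals hS (hn k) hu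
  · refine ⟨fun k => 1 / ((k : ℝ) + 1), fun _ => x, fun _ => φ, fun k => by positivity,
      tendsto_one_div_add_atTop_nhds_zero_nat, tendsto_const_nhds, tendsto_const_nhds,
      fun k => ⟨hx, ?_⟩⟩
    refine limsup_le_of_le (h := ?_)
    filter_upwards [self_mem_nhdsWithin] with u hu
    exact EReal.coe_le_coe_iff.2
      ((div_nonpos_of_nonpos_of_nonneg (h u hu.1) (norm_nonneg _)).trans (by positivity))

/-- Testing on the epigraph replaces extended-real inequalities by real ones, affine in `φ`;
convexity and weak-star closedness follow from this form. -/
theorem mem_convexSubdiff_iff {f : E → EReal} {x : E} {φ : StrongDual ℝ E} {c : ℝ} (hc : f x = c) :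
    φ ∈ convexSubdiff f x ↔ ∀ p ∈ epi f, c + φ (p.1 - x) ≤ p.2 := by
  constructor
  · rintro ⟨-, -, h⟩ p hp
    have := (h p.1).trans hp
    rw [hc] at this
    exact_mod_cast this
  · intro h
    refine ⟨by simp [hc], by simp [hc], fun y => ?_⟩
    rw [hc, ← EReal.coe_add]
    by_contra! hlt
    obtain ⟨r, hr, hr'⟩ := EReal.lt_iff_exists_real_btwn.1 hlt
    exact (h (y, r) hr.le).not_gt (EReal.coe_lt_coe_iff.1 hr')

theorem limitingSubdiff_eq_convexSubdiff [CompleteSpace E] {f : E → EReal} (hf : Convex ℝ (epi f))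
    (x : E) : limitingSubdiff f x = convexSubdiff f x := by
  by_cases hfin : f x ≠ ⊤ ∧ f x ≠ ⊥
  · obtain ⟨c, hc⟩ : ∃ c : ℝ, f x = c := ⟨_, (EReal.coe_toReal hfin.1 hfin.2).symm⟩
    ext φ
    rw [mem_convexSubdiff_iff hc]
    simp only [limitingSubdiff, mem_ofPred_eq, mem_limitingNormalCone_iff_of_convex hf]
    simp only [hc, epi, mem_ofPred_eq]
    simp
    refine forall₃_congr fun a b _ => ?_
    constructor <;> intro h <;> linarith
  · ext φ
    simp only [limitingSubdiff, convexSubdiff, mem_ofPred_eq]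
    tauto

theorem convex_convexSubdiff (f : E → EReal) (x : E) : Convex ℝ (convexSubdiff f x) := by
  by_cases hfin : f x ≠ ⊤ ∧ f x ≠ ⊥
  · obtain ⟨c, hc⟩ : ∃ c : ℝ, f x = c := ⟨_, (EReal.coe_toReal hfin.1 hfin.2).symm⟩
    intro φ hφ ψ hψ a b ha hb hab
    rw [mem_convexSubdiff_iff hc] at *
    intro p hp
    have h₁ := mul_le_mul_of_nonneg_left (hφ p hp) ha
    have h₂ := mul_le_mul_of_nonneg_left (hψ p hp) hb
    simp only [add_apply, smul_apply, smul_eq_mul]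
    obtain rfl : b = 1 - a := by linarith
    nlinarith
  · have : convexSubdiff f x = ∅ := by
      ext φ
      simp only [convexSubdiff, mem_ofPred_eq, mem_empty_iff_false]
      tauto
    rw [this]
    exact convex_empty

theorem isClosed_toWeakDual_image_convexSubdiff (f : E → EReal) (x : E) :
    IsClosed (StrongDual.toWeakDual '' convexSubdiff f x) := by
  by_cases hfin : f x ≠ ⊤ ∧ f x ≠ ⊥
  · obtain ⟨c, hc⟩ : ∃ c : ℝ, f x = c := ⟨_, (EReal.coe_toReal hfin.1 hfin.2).symm⟩
    have : StrongDual.toWeakDual '' convexSubdiff f x =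
        ⋂ p ∈ epi f, {φ : WeakDual ℝ E | c + φ (p.1 - x) ≤ p.2} := by
      ext φ
      simp only [mem_iInter₂, mem_ofPred_eq]
      constructor
      · rintro ⟨φ, hφ, rfl⟩
        exact (mem_convexSubdiff_iff hc).1 hφ
      · exact fun h => ⟨WeakDual.toStrongDual φ, (mem_convexSubdiff_iff hc).2 h, rfl⟩
    rw [this]
    exact isClosed_biInter fun p _ =>
      isClosed_le ((WeakDual.eval_continuous _).const_add c) continuous_const
  · have : convexSubdiff f x = ∅ := by
      ext φ
      simp only [convexSubdiff, mem_ofPred_eq, mem_empty_iff_false]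
      tauto
    simp [this]

theorem wstarClosedConvexHull_subset_convexSubdiff {f : E → EReal} {x : E}
    {A : Set (StrongDual ℝ E)} (hA : A ⊆ convexSubdiff f x) :
    wstarClosedConvexHull A ⊆ convexSubdiff f x := by
  intro φ hφ
  have h := closure_minimal (image_mono (convexHull_min hA (convex_convexSubdiff f x)))
    (isClosed_toWeakDual_image_convexSubdiff f x) hφ
  obtain ⟨ψ, hψ, hψφ⟩ := h
  exact StrongDual.toWeakDual.injective hψφ ▸ hψ

/-- A functional outside the weak-star closed convex hull is strictly separated from it by a
vector of the space. -/
theorem exists_separating_of_notMem_wstarClosedConvexHull {A : Set (StrongDual ℝ E)}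
    {φ : StrongDual ℝ E} (hφ : φ ∉ wstarClosedConvexHull A) :
    ∃ (d : E) (c : ℝ), (∀ ψ ∈ A, ψ d < c) ∧ c < φ d := by
  have : LocallyConvexSpace ℝ (WeakDual ℝ E) :=
    inferInstanceAs (LocallyConvexSpace ℝ (WeakBilin (topDualPairing ℝ E)))
  obtain ⟨g, c, hg, hc⟩ := geometric_hahn_banach_closed_point
    ((convex_convexHull ℝ A).linear_image StrongDual.toWeakDual.toLinearMap).closure
    isClosed_closure hφ
  -- Weak-star continuous functionals on the dual are evaluations at vectors.
  obtain ⟨d, hd⟩ := LinearMap.dualEmbedding_surjective (topDualPairing ℝ E) g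
  have hgd (ψ : StrongDual ℝ E) : g (StrongDual.toWeakDual ψ) = ψ d := by
    rw [← hd]; rfl
  refine ⟨d, c, fun ψ hψ => ?_, hc.trans_eq (hgd φ)⟩
  rw [← hgd]
  exact hg _ (subset_closure ⟨ψ, subset_convexHull ℝ A hψ, rfl⟩)

end NormalCone

/-! ### The scalarizing functional and the inner infimum -/

section Scalarization

variable {X Y : Type*} [NormedAddCommGroup Y] [NormedSpace ℝ Y] {K : PointedCone ℝ Y} {e : Y}

theorem add_mem_interior_cone {a b : Y} (ha : a ∈ interior (K : Set Y)) (hb : b ∈ K) :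
    a + b ∈ interior (K : Set Y) := by
  refine interior_mono ?_ (subset_interior_add_left (add_mem_add ha hb))
  rintro _ ⟨x, hx, y, hy, rfl⟩
  exact K.add_mem hx hy

theorem smul_mem_cone {r : ℝ} (hr : 0 ≤ r) {a : Y} (ha : a ∈ K) : r • a ∈ K :=
  K.smul_mem hr ha

theorem smul_mem_interior_cone {r : ℝ} (hr : 0 < r) {a : Y} (ha : a ∈ interior (K : Set Y)) :
    r • a ∈ interior (K : Set Y) := by
  have h : r • interior (K : Set Y) ⊆ interior (K : Set Y) := by
    rw [← interior_smul₀ hr.ne']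
    refine interior_mono ?_
    rintro _ ⟨x, hx, rfl⟩
    exact smul_mem_cone hr.le hx
  exact h (smul_mem_smul_set ha)

/-- Raising `t` to `r` adds a positive multiple of the interior point `e`; conversely, openness
leaves room to lower `r`. -/
theorem psi_lt_iff (he : e ∈ interior (K : Set Y)) {w : Y} {r : ℝ} :
    Psi (K : Set Y) e w < r ↔ r • e - w ∈ interior (K : Set Y) := by
  rw [Psi, sInf_lt_iff]
  constructor
  · rintro ⟨_, ⟨t, ht, rfl⟩, htr⟩
    rw [EReal.coe_lt_coe_iff] at htr
    rw [mem_ofPred_eq, singleton_sub] at ht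
    obtain ⟨k, hk, rfl⟩ := ht
    have := add_mem_interior_cone (smul_mem_interior_cone (sub_pos.2 htr) he) hk
    convert this using 1
    module
  · intro h
    have hcont : Continuous fun t : ℝ => t • e - w := by fun_prop
    have hnhds : {t : ℝ | t • e - w ∈ interior (K : Set Y)} ∈ 𝓝[<] r :=
      nhdsWithin_le_nhds (hcont.continuousAt.preimage_mem_nhds (isOpen_interior.mem_nhds h))
    obtain ⟨t, ht, htr⟩ := Filter.nonempty_of_mem (inter_mem hnhds self_mem_nhdsWithin)
    refine ⟨t, ⟨t, ?_, rfl⟩, EReal.coe_lt_coe_iff.2 htr⟩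
    rw [mem_ofPred_eq, singleton_sub]
    exact ⟨t • e - w, interior_subset ht, sub_sub_cancel _ _⟩

theorem psi_le_iff (hK : IsClosed (K : Set Y)) (he : e ∈ interior (K : Set Y)) {w : Y} {r : ℝ} :
    Psi (K : Set Y) e w ≤ r ↔ r • e - w ∈ K := by
  constructor
  · intro h
    have hcont : Continuous fun t : ℝ => t • e - w := by fun_prop
    refine hK.mem_of_tendsto ((hcont.tendsto r).mono_left (nhdsWithin_le_nhds (s := Ioi r))) ?_
    filter_upwards [self_mem_nhdsWithin] with t ht
    exact interior_subset ((psi_lt_iff he).1 (h.trans_lt (EReal.coe_lt_coe_iff.2 ht)))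
  · intro h
    refine sInf_le ⟨r, ?_, rfl⟩
    rw [mem_ofPred_eq, singleton_sub]
    exact ⟨_, h, sub_sub_cancel _ _⟩

theorem psi_zero (hK : IsClosed (K : Set Y)) (he : e ∈ interior (K : Set Y))
    (h0 : (0 : Y) ∉ interior (K : Set Y)) : Psi (K : Set Y) e 0 = (0 : ℝ) := by
  refine le_antisymm ((psi_le_iff hK he).2 (by simp)) (not_lt.1 fun h => h0 ?_)
  simpa using (psi_lt_iff he).1 h

theorem convex_epi_psi (hK : IsClosed (K : Set Y)) (he : e ∈ interior (K : Set Y)) :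
    Convex ℝ (epi (Psi (K : Set Y) e)) := by
  rintro ⟨w₁, r₁⟩ h₁ ⟨w₂, r₂⟩ h₂ a b ha hb -
  have h₁ := (psi_le_iff hK he).1 h₁
  have h₂ := (psi_le_iff hK he).1 h₂
  refine (psi_le_iff hK he).2 ?_
  convert K.add_mem (smul_mem_cone ha h₁) (smul_mem_cone hb h₂) using 1
  simp only [Prod.smul_mk, Prod.mk_add_mk, smul_eq_mul]
  module

theorem mem_convexSubdiff_psi_zero (hK : IsClosed (K : Set Y)) (he : e ∈ interior (K : Set Y))
    (h0 : (0 : Y) ∉ interior (K : Set Y)) {φ : StrongDual ℝ Y} (hφ : ∀ k ∈ K, 0 ≤ φ k)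
    (hφe : φ e = 1) : φ ∈ convexSubdiff (Psi (K : Set Y) e) 0 := by
  rw [mem_convexSubdiff_iff (psi_zero hK he h0)]
  intro p hp
  have := hφ _ ((psi_le_iff hK he).1 hp)
  simp [hφe] at this ⊢
  exact this

variable {F : X → Set Y}

theorem gLower_lt_iff (he : e ∈ interior (K : Set Y)) {x : X} {z : Y} {r : ℝ} :
    gLower (K : Set Y) e F x z < r ↔ ∃ y ∈ F x, r • e - (y - z) ∈ interior (K : Set Y) := by
  simp only [gLower, iInf_lt_iff, psi_lt_iff he, exists_prop]

/-- Moving `z` down in the order raises the value; this is why minimal points suffice in the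
supremum. -/
theorem gLower_le_gLower (he : e ∈ interior (K : Set Y)) {x : X} {z m : Y} (h : z - m ∈ K) :
    gLower (K : Set Y) e F x z ≤ gLower (K : Set Y) e F x m := by
  by_contra! hlt
  obtain ⟨r, hr, hr'⟩ := EReal.lt_iff_exists_real_btwn.1 hlt
  obtain ⟨y, hy, hyr⟩ := (gLower_lt_iff he).1 hr
  refine hr'.not_gt ((gLower_lt_iff he).2 ⟨y, hy, ?_⟩)
  convert add_mem_interior_cone hyr h using 1
  abel

theorem isClosed_setOf_le_gLower (he : e ∈ interior (K : Set Y)) (x : X) (r : ℝ) :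
    IsClosed {z | (r : EReal) ≤ gLower (K : Set Y) e F x z} := by
  have : {z | (r : EReal) ≤ gLower (K : Set Y) e F x z} =
      (⋃ y ∈ F x, {z | r • e - (y - z) ∈ interior (K : Set Y)})ᶜ := by
    ext z
    rw [mem_ofPred_eq, ← not_lt, gLower_lt_iff he]
    simp
  rw [this]
  refine (isOpen_biUnion fun y _ => isOpen_interior.preimage ?_).isClosed_compl
  fun_prop

theorem mem_gph_epiMap {x : X} {v : Y} :
    (x, v) ∈ gph (epiMap (K : Set Y) F) ↔ ∃ y ∈ F x, v - y ∈ K := by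
  simp only [gph, epiMap, mem_ofPred_eq, Set.mem_add]
  constructor
  · rintro ⟨y, hy, k, hk, rfl⟩
    exact ⟨y, hy, by simpa using hk⟩
  · rintro ⟨y, hy, h⟩
    exact ⟨y, hy, _, h, add_sub_cancel _ _⟩

end Scalarization

/-! ### Consequences of lower convexity; separation over a ray -/

section LowerConvex

variable {X Y : Type*} [NormedAddCommGroup X] [NormedSpace ℝ X]
  [NormedAddCommGroup Y] [NormedSpace ℝ Y] {K : PointedCone ℝ Y} {e : Y}
  {F : X → Set Y} {x₀ : X}

theorem LowerConvex.exists_le (hF : LowerConvex (K : Set Y) F) {x₁ x₂ : X} {y₁ y₂ : Y}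
    (h₁ : y₁ ∈ F x₁) (h₂ : y₂ ∈ F x₂) {a b : ℝ} (ha : 0 ≤ a) (hb : 0 ≤ b) (hab : a + b = 1) :
    ∃ y ∈ F (a • x₁ + b • x₂), a • y₁ + b • y₂ - y ∈ K := by
  rcases ha.eq_or_lt with rfl | ha
  · obtain rfl : b = 1 := by linarith
    exact ⟨y₂, by simpa using h₂, by simp⟩
  rcases hb.eq_or_lt with rfl | hb
  · obtain rfl : a = 1 := by linarith
    exact ⟨y₁, by simpa using h₁, by simp⟩
  obtain rfl : b = 1 - a := by linarith
  obtain ⟨y, hy, k, hk, hyk⟩ := hF x₁ ⟨y₁, h₁⟩ x₂ ⟨y₂, h₂⟩ a ha (by linarith)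
    (add_mem_add (smul_mem_smul_set h₁) (smul_mem_smul_set h₂))
  refine ⟨y, hy, ?_⟩
  rw [← hyk]
  simpa using hk

theorem LowerConvex.convex_gph_epiMap (hF : LowerConvex (K : Set Y) F) :
    Convex ℝ (gph (epiMap (K : Set Y) F)) := by
  rintro ⟨x₁, v₁⟩ h₁ ⟨x₂, v₂⟩ h₂ a b ha hb hab
  obtain ⟨y₁, hy₁, hk₁⟩ := mem_gph_epiMap.1 h₁
  obtain ⟨y₂, hy₂, hk₂⟩ := mem_gph_epiMap.1 h₂
  obtain ⟨y, hy, hk⟩ := hF.exists_le hy₁ hy₂ ha hb hab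
  refine mem_gph_epiMap.2 ⟨y, hy, ?_⟩
  convert K.add_mem (K.add_mem (smul_mem_cone ha hk₁) (smul_mem_cone hb hk₂)) hk using 1
  simp only [Prod.smul_mk]
  module

theorem LowerConvex.gLower_lt (hF : LowerConvex (K : Set Y) F) (he : e ∈ interior (K : Set Y))
    {x₁ x₂ : X} {z : Y} {r₁ r₂ : ℝ} (h₁ : gLower (K : Set Y) e F x₁ z < r₁)
    (h₂ : gLower (K : Set Y) e F x₂ z < r₂) {a b : ℝ} (ha : 0 ≤ a) (hb : 0 ≤ b) (hab : a + b = 1) :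
    gLower (K : Set Y) e F (a • x₁ + b • x₂) z < (a * r₁ + b * r₂ : ℝ) := by
  obtain ⟨y₁, hy₁, hk₁⟩ := (gLower_lt_iff he).1 h₁
  obtain ⟨y₂, hy₂, hk₂⟩ := (gLower_lt_iff he).1 h₂
  obtain ⟨y, hy, hk⟩ := hF.exists_le hy₁ hy₂ ha hb hab
  refine (gLower_lt_iff he).2 ⟨y, hy, ?_⟩
  convert add_mem_interior_cone (K.convex.interior hk₁ hk₂ ha hb hab) hk using 1
  obtain rfl : b = 1 - a := by linarith
  module

theorem LowerConvex.convex_epi_fLower (hF : LowerConvex (K : Set Y) F)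
    (he : e ∈ interior (K : Set Y)) : Convex ℝ (epi (fLower (K : Set Y) e F x₀)) := by
  rintro ⟨x₁, r₁⟩ h₁ ⟨x₂, r₂⟩ h₂ a b ha hb hab
  change (⨆ z ∈ F x₀, gLower (K : Set Y) e F (a • x₁ + b • x₂) z) ≤ ((a * r₁ + b * r₂ : ℝ) : EReal)
  refine iSup₂_le fun z hz => ?_
  by_contra! hlt
  obtain ⟨r, hr, hr'⟩ := EReal.lt_iff_exists_real_btwn.1 hlt
  have hr : a * r₁ + b * r₂ < r := EReal.coe_lt_coe_iff.1 hr
  have hg₁ : gLower (K : Set Y) e F x₁ z ≤ r₁ := (le_iSup₂ (f := fun z _ => gLower (K : Set Y) e F x₁ z) z hz).trans h₁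
  have hg₂ : gLower (K : Set Y) e F x₂ z ≤ r₂ := (le_iSup₂ (f := fun z _ => gLower (K : Set Y) e F x₂ z) z hz).trans h₂
  -- Raising both levels by this slack makes the bounds strict, as `gLower_lt` requires.
  set δ := r - (a * r₁ + b * r₂) with hδ
  have hδ0 : 0 < δ := by linarith
  have := hF.gLower_lt he (hg₁.trans_lt (EReal.coe_lt_coe_iff.2 (lt_add_of_pos_right r₁ hδ0)))
    (hg₂.trans_lt (EReal.coe_lt_coe_iff.2 (lt_add_of_pos_right r₂ hδ0))) ha hb hab
  have heq : a * (r₁ + δ) + b * (r₂ + δ) = r := by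
    linear_combination δ * hab + hδ
  rw [heq] at this
  exact hr'.not_gt this

/-- If `m ∈ F x₀`, the quotients `gLower (x₀ + t d) m / t` do not decrease in `t`. -/
theorem LowerConvex.le_gLower_ray (hF : LowerConvex (K : Set Y) F) (he : e ∈ interior (K : Set Y))
    {m : Y} (hm : m ∈ F x₀) {d : X} {α s t : ℝ} (ht : 0 < t) (hts : t ≤ s)
    (h : ((t * α : ℝ) : EReal) ≤ gLower (K : Set Y) e F (x₀ + t • d) m) :
    ((s * α : ℝ) : EReal) ≤ gLower (K : Set Y) e F (x₀ + s • d) m := by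
  have hs : 0 < s := ht.trans_le hts
  by_contra! hlt
  obtain ⟨v, hv, hvs⟩ := (gLower_lt_iff he).1 hlt
  -- `x₀ + t d` is the combination of `x₀ + s d` and `x₀` with weights `t / s` and `1 - t / s`.
  obtain ⟨y, hy, hk⟩ := hF.exists_le hv hm (div_nonneg ht.le hs.le)
    (sub_nonneg.2 ((div_le_one hs).2 hts)) (add_sub_cancel _ _)
  refine h.not_gt ((gLower_lt_iff he).2 ⟨y, ?_, ?_⟩)
  · convert hy using 2
    have : t • d = (t / s) • s • d := by rw [smul_smul, div_mul_cancel₀ _ hs.ne']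
    rw [this]
    module
  · convert add_mem_interior_cone (smul_mem_interior_cone (div_pos ht hs) hvs) hk using 1
    have : (t * α) • e = (t / s) • (s * α) • e := by
      rw [smul_smul, ← mul_assoc, div_mul_cancel₀ _ hs.ne']
    rw [this]
    module

/-- The linear form of the subgradient inequality for a minimal point, obtained by separating the
interior of a convex set from a shifted cone over a ray. -/
theorem exists_support_of_ray {G : Set (X × Y)} (hG : Convex ℝ G) (he : e ∈ interior (K : Set Y))
    {m w : Y} (hm : (x₀, m) ∈ G) (hw : (x₀, w) ∈ interior G) {d : X} {α : ℝ}
    (hray : ∀ s : ℝ, 0 ≤ s → ∀ v, (x₀ + s • d, v) ∈ G →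
      (s * α) • e - (v - m) ∉ interior (K : Set Y)) :
    ∃ (ξ : StrongDual ℝ X) (η : StrongDual ℝ Y), (∀ k ∈ K, 0 ≤ η k) ∧ η e = 1 ∧
      (∀ p ∈ G, ξ (p.1 - x₀) ≤ η (p.2 - m)) ∧ α ≤ ξ d := by
  set C : Set (X × Y) :=
    {p | ∃ s : ℝ, 0 ≤ s ∧ p.1 = x₀ + s • d ∧ (s * α) • e - (p.2 - m) ∈ interior (K : Set Y)}
    with hCdef
  have hC : Convex ℝ C := by
    rintro ⟨x₁, v₁⟩ ⟨s₁, hs₁, hx₁, hv₁⟩ ⟨x₂, v₂⟩ ⟨s₂, hs₂, hx₂, hv₂⟩ a b ha hb hab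
    refine ⟨a * s₁ + b * s₂, by positivity, ?_, ?_⟩
    · obtain rfl : b = 1 - a := by linarith
      simp only at hx₁ hx₂
      simp only [Prod.smul_mk, Prod.mk_add_mk, hx₁, hx₂]
      module
    · convert K.convex.interior hv₁ hv₂ ha hb hab using 1
      obtain rfl : b = 1 - a := by linarith
      simp only [Prod.smul_mk, Prod.mk_add_mk]
      module
  have hdisj : Disjoint (interior G) C := by
    rw [Set.disjoint_left]
    rintro ⟨x, v⟩ hxG ⟨s, hs, hx, hv⟩
    simp only at hx
    subst hx
    exact hray s hs v (interior_subset hxG) hv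
  obtain ⟨f, c, hfG, hfC⟩ := geometric_hahn_banach_open hG.interior isOpen_interior hC hdisj
  have hfG' (p) (hp : p ∈ G) : f p ≤ c := by
    have hcl : p ∈ closure (interior G) := by
      rw [hG.closure_interior_eq_closure_of_nonempty_interior ⟨_, hw⟩]
      exact subset_closure hp
    exact closure_minimal (fun q hq => (hfG q hq).le)
      (isClosed_le f.continuous continuous_const) hcl
  have hsplit (x : X) (y : Y) : f (x, y) = f (x, 0) + f (0, y) := by
    rw [← map_add]; simp
  -- The separation inequality passed to boundary points of `C`, approached by subtracting `δ e`
  -- with `δ → 0`. Below, `s = 0` gives the constant `c` and the sign of `f` on `K`; `s = 1`, `k =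
  -- 0` gives the bound in direction `d`.
  have hcone (s : ℝ) (hs : 0 ≤ s) (k : Y) (hk : k ∈ K) :
      c ≤ f (x₀, m) + s * (f (d, 0) + α * f (0, e)) - f (0, k) := by
    refine le_of_forall_pos_le_add fun ε hε => ?_
    obtain ⟨δ, hδ, hδε⟩ : ∃ δ : ℝ, 0 < δ ∧ -(δ * f (0, e)) ≤ ε := by
      refine ⟨ε / (|f (0, e)| + 1), by positivity, ?_⟩
      have h1 : -f (0, e) ≤ |f (0, e)| + 1 := by linarith [neg_le_abs (f (0, e))]
      rw [← mul_neg, div_mul_eq_mul_div, div_le_iff₀ (by positivity)]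
      exact mul_le_mul_of_nonneg_left h1 hε.le
    have hmem : (x₀ + s • d, m + (s * α) • e - (δ • e + k)) ∈ C := by
      refine ⟨s, hs, rfl, ?_⟩
      convert add_mem_interior_cone (smul_mem_interior_cone hδ he) hk using 1
      module
    have h2 := hfC _ hmem
    have h3 : (x₀ + s • d, m + (s * α) • e - (δ • e + k)) =
        (x₀, m) + s • ((d, 0) + α • ((0 : X), e)) - (δ • ((0 : X), e) + ((0 : X), k)) := by
      ext
      · simp
      · simp [smul_smul]
    rw [h3] at h2
    simp only [map_add, map_sub, map_smul, smul_eq_mul] at h2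
    linarith
  have hcm : f (x₀, m) = c := le_antisymm (hfG' _ hm) <| by
    simpa [← Prod.zero_eq_mk] using hcone 0 le_rfl 0 K.zero_mem
  have hneg (k : Y) (hk : k ∈ K) : f (0, k) ≤ 0 := by
    have := hcone 0 le_rfl k hk
    linarith
  have hd : 0 ≤ f (d, 0) + α * f (0, e) := by
    have := hcone 1 zero_le_one 0 K.zero_mem
    rw [← Prod.zero_eq_mk, map_zero] at this
    linarith
  -- The hyperplane is not vertical: `G` has an interior point over `x₀`. Dividing by this number
  -- normalizes `η e = 1`.
  have hβ : 0 < -f (0, e) := by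
    have hwm : f (0, w - m) < 0 := by
      have h1 := hfG _ hw
      have h2 : ((0 : X), w - m) = (x₀, w) - (x₀, m) := by simp
      rw [h2, map_sub]
      linarith
    have hcont : Continuous fun δ : ℝ => e - δ • (w - m) := by fun_prop
    have hnhds : {δ : ℝ | e - δ • (w - m) ∈ interior (K : Set Y)} ∈ 𝓝[>] 0 :=
      nhdsWithin_le_nhds (hcont.continuousAt.preimage_mem_nhds
        (isOpen_interior.mem_nhds (by simpa using he)))
    obtain ⟨δ, hδ, hδ0⟩ := Filter.nonempty_of_mem (inter_mem hnhds self_mem_nhdsWithin)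
    have h3 := hneg _ (interior_subset hδ)
    have h4 : ((0 : X), e - δ • (w - m)) = (0, e) - δ • ((0 : X), w - m) := by simp
    rw [h4, map_sub, map_smul, smul_eq_mul] at h3
    have := mul_pos_of_neg_of_neg (neg_neg_of_pos hδ0) hwm
    linarith
  set β := -f (0, e) with hβdef
  refine ⟨β⁻¹ • f.comp (.inl ℝ X Y), -(β⁻¹ • f.comp (.inr ℝ X Y)), fun k hk => ?_, ?_, ?_, ?_⟩
  · have := mul_nonneg (inv_pos.2 hβ).le (neg_nonneg.2 (hneg k hk))
    simpa using this
  · have : -(β⁻¹ * f (0, e)) = 1 := by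
      rw [← mul_neg, ← hβdef, inv_mul_cancel₀ hβ.ne']
    simpa using this
  · rintro ⟨x, v⟩ hp
    have h1 := hfG' _ hp
    have h2 : f (x, v) = f (x₀, m) + (f (x - x₀, 0) + f (0, v - m)) := by
      rw [← hsplit, ← map_add]; simp
    have h3 : f (x - x₀, 0) ≤ -f (0, v - m) := by linarith
    have := mul_le_mul_of_nonneg_left h3 (inv_pos.2 hβ).le
    rw [mul_neg] at this
    simpa using this
  · have : α ≤ β⁻¹ * f (d, 0) := by
      rw [le_inv_mul_iff₀ hβ]
      linarith
    simpa using this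

end LowerConvex

/-! ### Existence of minimal points -/

section Minimal

variable {Y : Type*} [NormedAddCommGroup Y] [NormedSpace ℝ Y] {K : PointedCone ℝ Y}

theorem mem_MinSet_iff {A : Set Y} {m : Y} :
    m ∈ MinSet A (K : Set Y) ↔ m ∈ A ∧ ∀ y ∈ A, m - y ∈ K → y = m := by
  refine and_congr_right fun hm => ⟨fun h y hy hk => ?_, fun h => ?_⟩
  · have : y ∈ ({m} - (K : Set Y)) ∩ A :=
      ⟨by rw [singleton_sub]; exact ⟨_, hk, sub_sub_cancel _ _⟩, hy⟩
    rw [h] at this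
    exact this
  · refine Subset.antisymm ?_ ?_
    · rintro y ⟨hy, hyA⟩
      rw [singleton_sub] at hy
      obtain ⟨k, hk, rfl⟩ := hy
      exact h _ hyA (by simpa using hk)
    · rintro _ rfl
      exact ⟨by rw [singleton_sub]; exact ⟨0, K.zero_mem, by simp⟩, hm⟩

theorem eq_of_sub_mem_cone (hK : (K : Set Y) ∩ -(K : Set Y) = {0}) {a b : Y} (h₁ : a - b ∈ K)
    (h₂ : b - a ∈ K) : a = b := by
  have : a - b ∈ (K : Set Y) ∩ -(K : Set Y) := ⟨h₁, by simpa using h₂⟩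
  rw [hK] at this
  exact sub_eq_zero.1 this

/-- Every element of a nonempty compact set dominates a minimal one. -/
theorem IsCompact.exists_minimal_le {B : Set Y} (hB : IsCompact B) (hK : IsClosed (K : Set Y))
    {z : Y} (hz : z ∈ B) : ∃ m ∈ B, z - m ∈ K ∧ ∀ y ∈ B, m - y ∈ K → y - m ∈ K := by
  have hclosed (a : Y) : IsClosed {y | a - y ∈ K} := hK.preimage (continuous_const.sub continuous_id)
  have hchain (c : Set {b // b ∈ B ∧ z - b ∈ K}) (hc : IsChain (fun a b => a.1 - b.1 ∈ K) c) :
      ∃ b : {b // b ∈ B ∧ z - b ∈ K}, ∀ a ∈ c, a.1 - b.1 ∈ K := by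
    rcases c.eq_empty_or_nonempty with rfl | ⟨a₀, ha₀⟩
    · exact ⟨⟨z, hz, by simp⟩, by simp⟩
    have : Nonempty c := ⟨⟨a₀, ha₀⟩⟩
    have hdir : Directed (· ⊇ ·) fun a : c => B ∩ {y | a.1.1 - y ∈ K} := by
      have key {a b : c} (h : a.1.1 - b.1.1 ∈ K) :
          B ∩ {y | b.1.1 - y ∈ K} ⊆ B ∩ {y | a.1.1 - y ∈ K} :=
        fun y hy => ⟨hy.1, by simpa using K.add_mem h hy.2⟩
      intro a b
      rcases eq_or_ne a b with rfl | hne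
      · exact ⟨a, Subset.rfl, Subset.rfl⟩
      rcases hc a.2 b.2 (Subtype.coe_injective.ne hne) with h | h
      · exact ⟨b, key h, Subset.rfl⟩
      · exact ⟨a, Subset.rfl, key h⟩
    obtain ⟨b, hb⟩ := IsCompact.nonempty_iInter_of_directed_nonempty_isCompact_isClosed _ hdir
      (fun a => ⟨a.1.1, a.1.2.1, by simp⟩) (fun a => hB.inter_right (hclosed _))
      (fun a => hB.isClosed.inter (hclosed _))
    rw [mem_iInter] at hb
    have hzb : z - b ∈ K := by simpa using K.add_mem a₀.2.2 (hb ⟨a₀, ha₀⟩).2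
    exact ⟨⟨b, (hb ⟨a₀, ha₀⟩).1, hzb⟩, fun a ha => (hb ⟨a, ha⟩).2⟩
  -- Zorn's lemma for the cone preorder; chains are bounded because nested compact sections of `B`
  -- have a common point.
  obtain ⟨m, hm⟩ := exists_maximal_of_chains_bounded hchain fun {a b d} hab hbd => by
    simpa using K.add_mem hab hbd
  refine ⟨m, m.2.1, m.2.2, fun y hy hmy => hm ⟨y, hy, ?_⟩ hmy⟩
  simpa using K.add_mem m.2.2 hmy

theorem MinSet_subset_of_lowerLess {A B : Set Y} (hBA : B ⊆ A) (h : LowerLess (K : Set Y) B A) :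
    MinSet A (K : Set Y) ⊆ B := by
  intro m hm
  rw [mem_MinSet_iff] at hm
  obtain ⟨b, hb, k, hk, hbk⟩ := h hm.1
  rwa [← hm.2 b (hBA hb) (by rw [← hbk]; simpa using hk)]

/-- A minimal point of the compact subset `B` is minimal in `A`, since `B` dominates `A` from below
and pointedness turns equivalence into equality. -/
theorem exists_mem_MinSet_le (hKclosed : IsClosed (K : Set Y))
    (hK : (K : Set Y) ∩ -(K : Set Y) = {0}) {A : Set Y} (hA : StronglyCompact (K : Set Y) A)
    {z : Y} (hz : z ∈ A) : ∃ m ∈ MinSet A (K : Set Y), z - m ∈ K := by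
  obtain ⟨B, hBA, hB, hle, -⟩ := hA
  have hdom {z : Y} (hz : z ∈ A) : ∃ b ∈ B, z - b ∈ K := by
    obtain ⟨b, hb, k, hk, rfl⟩ := hle hz
    exact ⟨b, hb, by simpa using hk⟩
  obtain ⟨b, hb, hzb⟩ := hdom hz
  obtain ⟨m, hmB, hbm, hmin⟩ := IsCompact.exists_minimal_le hB hKclosed hb
  refine ⟨m, mem_MinSet_iff.2 ⟨hBA hmB, fun y hy hmy => ?_⟩, by simpa using K.add_mem hzb hbm⟩
  obtain ⟨b', hb', hyb'⟩ := hdom hy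
  have h1 : b' - m ∈ K := hmin b' hb' (by simpa using K.add_mem hmy hyb')
  exact eq_of_sub_mem_cone hK (by simpa using K.add_mem hyb' h1) hmy

end Minimal

/-! ### The two inclusions -/

section Main

variable {X Y : Type*} [NormedAddCommGroup Y] [NormedSpace ℝ Y] {K : PointedCone ℝ Y} {e : Y}
  {F : X → Set Y} {x₀ : X}

theorem fLower_self (hKclosed : IsClosed (K : Set Y)) (hK : (K : Set Y) ∩ -(K : Set Y) = {0})
    (he : e ∈ interior (K : Set Y)) (h0 : (0 : Y) ∉ interior (K : Set Y))
    (hcomp : StronglyCompact (K : Set Y) (F x₀)) (hne : (F x₀).Nonempty) :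
    fLower (K : Set Y) e F x₀ x₀ = (0 : ℝ) := by
  refine le_antisymm (iSup₂_le fun z hz => ?_) ?_
  · refine (iInf₂_le z hz).trans ?_
    rw [sub_self, psi_zero hKclosed he h0]
  · obtain ⟨z, hz⟩ := hne
    obtain ⟨m, hm, -⟩ := exists_mem_MinSet_le hKclosed hK hcomp hz
    rw [mem_MinSet_iff] at hm
    refine le_iSup₂_of_le m hm.1 (not_lt.1 fun hlt => ?_)
    obtain ⟨y, hy, hym⟩ := (gLower_lt_iff he).1 hlt
    have hym : m - y ∈ interior (K : Set Y) := by simpa using hym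
    obtain rfl := hm.2 y hy (interior_subset hym)
    exact h0 (by simpa using hym)

/-- A cone with `0` in its interior is the whole space, which makes `Psi` identically `⊥`. -/
theorem zero_notMem_interior_cone_of_psi_ne_bot (he : e ∈ interior (K : Set Y)) {w : Y}
    (h : Psi (K : Set Y) e w ≠ ⊥) : (0 : Y) ∉ interior (K : Set Y) := by
  intro h0
  have huniv (v : Y) : v ∈ interior (K : Set Y) := by
    have hcont : Continuous fun δ : ℝ => δ • v := by fun_prop
    have hnhds : {δ : ℝ | δ • v ∈ interior (K : Set Y)} ∈ 𝓝[>] 0 :=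
      nhdsWithin_le_nhds (hcont.continuousAt.preimage_mem_nhds
        (isOpen_interior.mem_nhds (by simpa using h0)))
    obtain ⟨δ, hδ, hδ0⟩ := Filter.nonempty_of_mem (inter_mem hnhds self_mem_nhdsWithin)
    have hδ0 : 0 < δ := hδ0
    have := smul_mem_interior_cone (inv_pos.2 hδ0) hδ
    rwa [smul_smul, inv_mul_cancel₀ hδ0.ne', one_smul] at this
  refine h (EReal.eq_bot_iff_forall_lt _ |>.2 fun r => (psi_lt_iff he).2 (huniv _))

theorem fLower_self_eq_bot (he : e ∈ interior (K : Set Y)) (h0 : (0 : Y) ∈ interior (K : Set Y)) :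
    fLower (K : Set Y) e F x₀ x₀ = ⊥ := by
  refine eq_bot_iff.2 (iSup₂_le fun z hz => (iInf₂_le z hz).trans ?_)
  by_contra h
  exact zero_notMem_interior_cone_of_psi_ne_bot he (fun hb => h hb.le) h0

variable [NormedAddCommGroup X]

/-- The graph of the epigraphical multifunction has interior points over `x₀`. -/
theorem exists_mem_interior_gph_epiMap (he : e ∈ interior (K : Set Y))
    (hdom : dom F ∈ 𝓝 x₀) (hbdd : LocallyLBounded (K : Set Y) e F x₀) :
    ∃ w, (x₀, w) ∈ interior (gph (epiMap (K : Set Y) F)) := by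
  obtain ⟨U, hU, ⟨μ, -, hμ⟩, -⟩ := hbdd
  -- Near `x₀` each value of `F` has an element below `μ • e`; the extra `e` leaves room for
  -- perturbations.
  refine ⟨μ • e + e, mem_interior_iff_mem_nhds.2 ?_⟩
  have hV : {v | v - μ • e ∈ interior (K : Set Y)} ∈ 𝓝 (μ • e + e) :=
    (isOpen_interior.preimage (continuous_id.sub continuous_const)).mem_nhds (by simpa using he)
  filter_upwards [prod_mem_nhds (inter_mem hU hdom) hV]
  rintro ⟨x, v⟩ ⟨⟨hxU, z, hz⟩, hv⟩
  obtain ⟨y, ⟨hy, hyμ⟩, -⟩ := (hμ x hxU).1 hz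
  rw [singleton_sub] at hyμ
  obtain ⟨k, hk, rfl⟩ := hyμ
  refine mem_gph_epiMap.2 ⟨_, hy, ?_⟩
  convert K.add_mem (interior_subset hv) hk using 1
  simp only
  abel

variable [NormedSpace ℝ X]

/-- If `fLower` grows at least at rate `c` along a ray, so does `gLower` for a single minimal
point. -/
theorem exists_mem_MinSet_forall_le_gLower (hKclosed : IsClosed (K : Set Y))
    (hK : (K : Set Y) ∩ -(K : Set Y) = {0}) (he : e ∈ interior (K : Set Y))
    (hconv : LowerConvex (K : Set Y) F) (hcomp : StronglyCompact (K : Set Y) (F x₀))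
    {d : X} {c : ℝ} (h : ∀ t : ℝ, 0 < t → ((t * c : ℝ) : EReal) <
      fLower (K : Set Y) e F x₀ (x₀ + t • d)) :
    ∃ m ∈ MinSet (F x₀) (K : Set Y), ∀ t : ℝ, 0 < t →
      ((t * c : ℝ) : EReal) ≤ gLower (K : Set Y) e F (x₀ + t • d) m := by
  obtain ⟨B, hBF, hB, hle, -⟩ := id hcomp
  -- Points of `B` at which the bound holds for every `s ≥ t`. These compact sets shrink as `t`
  -- decreases, and ray monotonicity keeps them nonempty, so a common point serves all `t > 0`.
  let A : Ioi (0 : ℝ) → Set Y := fun t =>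
    B ∩ ⋂ s ∈ Ici (t : ℝ), {z | ((s * c : ℝ) : EReal) ≤ gLower (K : Set Y) e F (x₀ + s • d) z}
  have hclosed (t) : IsClosed (⋂ s ∈ Ici (t : ℝ),
      {z | ((s * c : ℝ) : EReal) ≤ gLower (K : Set Y) e F (x₀ + s • d) z}) :=
    isClosed_biInter fun s _ => isClosed_setOf_le_gLower he _ _
  have hmono {t t' : Ioi (0 : ℝ)} (htt : t ≤ t') : A t ⊆ A t' :=
    inter_subset_inter_right _ (biInter_subset_biInter_left (Ici_subset_Ici.2 htt))
  have : Nonempty (Ioi (0 : ℝ)) := ⟨⟨1, mem_Ioi.2 one_pos⟩⟩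
  obtain ⟨b, hb⟩ := IsCompact.nonempty_iInter_of_directed_nonempty_isCompact_isClosed A
    (fun t t' => ⟨min t t', hmono (min_le_left _ _), hmono (min_le_right _ _)⟩)
    (fun t => by
      obtain ⟨z, hz, hzt⟩ : ∃ z ∈ F x₀, ((t * c : ℝ) : EReal) <
          gLower (K : Set Y) e F (x₀ + (t : ℝ) • d) z := by
        simpa only [fLower, lt_iSup_iff, exists_prop] using h t t.2
      obtain ⟨m, hm, hzm⟩ := exists_mem_MinSet_le hKclosed hK hcomp hz
      refine ⟨m, MinSet_subset_of_lowerLess hBF hle hm, mem_iInter₂.2 fun s hs => ?_⟩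
      exact hconv.le_gLower_ray he hm.1 t.2 hs (hzt.le.trans (gLower_le_gLower he hzm)))
    (fun t => hB.inter_right (hclosed t)) (fun t => hB.isClosed.inter (hclosed t))
  rw [mem_iInter] at hb
  obtain ⟨m, hm, hbm⟩ := exists_mem_MinSet_le hKclosed hK hcomp (hBF (hb ⟨1, mem_Ioi.2 one_pos⟩).1)
  refine ⟨m, hm, fun t ht => le_trans ?_ (gLower_le_gLower he hbm)⟩
  exact mem_iInter₂.1 (hb ⟨t, ht⟩).2 t self_mem_Ici

theorem mem_coderivative_epiMap_iff [CompleteSpace X] [CompleteSpace Y]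
    (hconv : LowerConvex (K : Set Y) F) {y : Y} (hy : y ∈ F x₀) {ξ : StrongDual ℝ X}
    {η : StrongDual ℝ Y} :
    ξ ∈ coderivative (epiMap (K : Set Y) F) x₀ y η ↔
      ∀ p ∈ gph (epiMap (K : Set Y) F), ξ (p.1 - x₀) ≤ η (p.2 - y) := by
  rw [coderivative, mem_ofPred_eq, mem_limitingNormalCone_iff_of_convex hconv.convex_gph_epiMap,
    and_iff_right (mem_gph_epiMap.2 ⟨y, hy, by simp⟩)]
  refine forall₂_congr fun p _ => ?_
  simp only [ContinuousLinearMap.coprod_apply, Prod.fst_sub, Prod.snd_sub, neg_apply]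
  constructor <;> intro h <;> linarith

theorem coderivative_subset_convexSubdiff_fLower [CompleteSpace X] [CompleteSpace Y]
    (hKclosed : IsClosed (K : Set Y)) (hK : (K : Set Y) ∩ -(K : Set Y) = {0})
    (he : e ∈ interior (K : Set Y)) (hconv : LowerConvex (K : Set Y) F)
    (hcomp : StronglyCompact (K : Set Y) (F x₀)) {y : Y} (hy : y ∈ F x₀) {η : StrongDual ℝ Y}
    (hη : η ∈ convexSubdiff (Psi (K : Set Y) e) 0) :
    coderivative (epiMap (K : Set Y) F) x₀ y η ⊆ convexSubdiff (fLower (K : Set Y) e F x₀) x₀ := by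
  intro ξ hξ
  rw [mem_coderivative_epiMap_iff hconv hy] at hξ
  have h0 := zero_notMem_interior_cone_of_psi_ne_bot he hη.2.1
  have hf := fLower_self hKclosed hK he h0 hcomp ⟨y, hy⟩
  refine ⟨by simp [hf], by simp [hf], fun x => ?_⟩
  rw [hf, ← EReal.coe_add, zero_add]
  refine le_iSup₂_of_le y hy (le_iInf₂ fun v hv => ?_)
  have h1 := hη.2.2 (v - y)
  rw [psi_zero hKclosed he h0, ← EReal.coe_add, zero_add, sub_zero] at h1
  exact (EReal.coe_le_coe_iff.2 (hξ (x, v) (mem_gph_epiMap.2 ⟨v, hv, by simp⟩))).trans h1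

theorem convexSubdiff_fLower_subset [CompleteSpace X] [CompleteSpace Y]
    (hKclosed : IsClosed (K : Set Y)) (hK : (K : Set Y) ∩ -(K : Set Y) = {0})
    (he : e ∈ interior (K : Set Y)) (hdom : dom F ∈ 𝓝 x₀) (hconv : LowerConvex (K : Set Y) F)
    (hbdd : LocallyLBounded (K : Set Y) e F x₀) (hcomp : StronglyCompact (K : Set Y) (F x₀)) :
    convexSubdiff (fLower (K : Set Y) e F x₀) x₀ ⊆
      wstarClosedConvexHull
        (⋃ y ∈ MinSet (F x₀) (K : Set Y), ⋃ ystar ∈ convexSubdiff (Psi (K : Set Y) e) 0,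
          coderivative (epiMap (K : Set Y) F) x₀ y ystar) := by
  intro φ hφ
  by_contra hnot
  have h0 : (0 : Y) ∉ interior (K : Set Y) := fun h0 => hφ.2.1 (fLower_self_eq_bot he h0)
  have hf := fLower_self hKclosed hK he h0 hcomp (show x₀ ∈ dom F from mem_of_mem_nhds hdom)
  obtain ⟨d, c, hsep, hcd⟩ := exists_separating_of_notMem_wstarClosedConvexHull hnot
  obtain ⟨m, hm, hray⟩ := exists_mem_MinSet_forall_le_gLower (c := c) (d := d)
    hKclosed hK he hconv hcomp (fun t ht => by
      have h1 := hφ.2.2 (x₀ + t • d)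
      rw [hf, ← EReal.coe_add, zero_add, add_sub_cancel_left, map_smul, smul_eq_mul] at h1
      exact (EReal.coe_lt_coe_iff.2 (mul_lt_mul_of_pos_left hcd ht)).trans_le h1)
  have hmin := mem_MinSet_iff.1 hm
  obtain ⟨w, hw⟩ := exists_mem_interior_gph_epiMap he hdom hbdd
  have hmG : (x₀, m) ∈ gph (epiMap (K : Set Y) F) := mem_gph_epiMap.2 ⟨m, hmin.1, by simp⟩
  obtain ⟨ξ, η, hηK, hηe, hξη, hcξ⟩ := exists_support_of_ray (α := c) (d := d)
    hconv.convex_gph_epiMap he hmG hw (fun s hs v hv hint => by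
      obtain ⟨y, hy, hk⟩ := mem_gph_epiMap.1 hv
      have h1 : (s * c) • e - (y - m) ∈ interior (K : Set Y) := by
        convert add_mem_interior_cone hint hk using 1
        abel
      rcases hs.eq_or_lt with rfl | hs
      · simp only [zero_mul, zero_smul, zero_sub, neg_sub, add_zero] at h1 hy
        obtain rfl := hmin.2 y hy (interior_subset h1)
        exact h0 (by simpa using h1)
      · exact (hray s hs).not_gt ((gLower_lt_iff he).2 ⟨y, hy, h1⟩))
  -- `ξ` belongs to the separated union, yet `c ≤ ξ d`.
  refine (hsep ξ ?_).not_ge hcξ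
  exact mem_biUnion hm (mem_biUnion (mem_convexSubdiff_psi_zero hKclosed he h0 hηK hηe)
    ((mem_coderivative_epiMap_iff hconv hmin.1).2 hξη))

end Main

end SetOpt

theorem mainTheorem5 {X Y : Type*}
    [NormedAddCommGroup X] [NormedSpace ℝ X] [CompleteSpace X]
    [NormedAddCommGroup Y] [NormedSpace ℝ Y] [CompleteSpace Y]
    (K : PointedCone ℝ Y) (hKclosed : IsClosed (K : Set Y))
    (hKpointed : (K : Set Y) ∩ -(K : Set Y) = {0})
    (e : Y) (he : e ∈ interior (K : Set Y))
    (Ω : Set X) (hΩ : IsClosed Ω) (x₀ : X) (hx₀ : x₀ ∈ Ω)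
    (F : X → Set Y) (hdom : Ω ⊆ interior (dom F))
    (hconv : LowerConvex (K : Set Y) F)
    (hbdd : LocallyLBounded (K : Set Y) e F x₀)
    (hcomp : StronglyCompact (K : Set Y) (F x₀)) :
    limitingSubdiff (fLower (K : Set Y) e F x₀) x₀ =
        wstarClosedConvexHull
          (⋃ y ∈ MinSet (F x₀) (K : Set Y), ⋃ ystar ∈ limitingSubdiff (Psi (K : Set Y) e) 0,
            coderivative (epiMap (K : Set Y) F) x₀ y ystar) ∧
      convexSubdiff (fLower (K : Set Y) e F x₀) x₀ =
        wstarClosedConvexHull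
          (⋃ y ∈ MinSet (F x₀) (K : Set Y), ⋃ ystar ∈ limitingSubdiff (Psi (K : Set Y) e) 0,
            coderivative (epiMap (K : Set Y) F) x₀ y ystar) := by
  have hnhds : dom F ∈ 𝓝 x₀ := mem_interior_iff_mem_nhds.1 (hdom hx₀)
  rw [limitingSubdiff_eq_convexSubdiff (hconv.convex_epi_fLower he),
    limitingSubdiff_eq_convexSubdiff (convex_epi_psi hKclosed he), and_self]
  refine Subset.antisymm (convexSubdiff_fLower_subset hKclosed hKpointed he hnhds hconv hbdd hcomp)
    (wstarClosedConvexHull_subset_convexSubdiff (iUnion₂_subset fun y hy => iUnion₂_subset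
      fun η hη => ?_))
  exact coderivative_subset_convexSubdiff_fLower hKclosed hKpointed he hconv hcomp hy.1 hη
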